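/- Let $\Bbbk$ be an algebraically closed field and $A$ a finite-dimensional unital associative $\Bbbk$-algebra which is basic (all simple $A$-modules are one-dimensional over $\Bbbk$), and let $A\text{-mod}$ be the category of finitely generated (equivalently, finite-dimensional) left $A$-modules. Let $L_1,\dots,L_n$ be a complete list of pairwise non-isomorphic simple $A$-modules and let $P_i$ be the projective cover of $L_i$. Let $S\subsetneq\{1,\dots,n\}$ be a proper subset, $S'=\{1,\dots,n\}\setminus S$, and $P_{S'}=\bigoplus_{i\in S'}P_i$. Let $\mathcal N_S$ be the Serre subcategory of $A\text{-mod}$ consisting of all modules $N$ such that every composition factor of $N$ isomorphic to some $L_i$ has $i\in S$. Let $\mathcal Q_S=A\text{-mod}/\mathcal N_S$ be the Serre quotient, i.e. the localization of $A\text{-mod}$ at all homomorphisms whose kernel and cokernel lie in $\mathcal N_S$. Let $\mathrm{add}(P_{S'})$ be the class of modules isomorphic to finite direct sums of direct summands of $P_{S'}$, let $\mathcal X_{P_{S'}}$ be the full subcategory of $A\text{-mod}$ of all modules $Y$ which admit an exact sequence $X_1\to X_0\to Y\to 0$ with $X_0,X_1\in\mathrm{add}(P_{S'})$, and let $B_{S'}=\mathrm{End}_A(P_{S'})^{\mathrm{op}}$,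 with $B_{S'}\text{-mod}$ the category of finitely generated left $B_{S'}$-modules. Then there are $\Bbbk$-linear equivalences of categories $$\mathcal Q_S\;\cong\;\mathcal X_{P_{S'}}\;\cong\;B_{S'}\text{-mod}.$$ More precisely, the composition $\mathcal X_{P_{S'}}\hookrightarrow A\text{-mod}\to\mathcal Q_S$ of the inclusion with the canonical quotient functor is quasi-inverse to the first equivalence, and the second equivalence is isomorphic to the functor $\mathrm{Hom}_A(P_{S'},-)$. -/

import Mathlib

open CategoryTheory

universe w u

namespace SerreQuot

section Basic

/-- A `k`-algebra `A` is basic if all simple `A`-modules are one-dimensional over `k`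
(the definition for `k` algebraically closed and `A` finite dimensional). -/
def IsBasicAlgebra (k : Type w) (A : Type u) [Field k] [Ring A] [Algebra k A] : Prop :=
  ∀ (M : Type u) [AddCommGroup M] [Module k M] [Module A M] [IsScalarTower k A M],
    IsSimpleModule A M → Module.finrank k M = 1

/-- `π : P → L` is a projective cover: `P` is projective and `π` is surjective with superfluous
kernel. -/
structure IsProjectiveCover {A : Type u} [Ring A] {P L : Type u} [AddCommGroup P] [Module A P]
    [AddCommGroup L] [Module A L] (π : P →ₗ[A] L) : Prop where
  projective : Module.Projective A P
  surjective : Function.Surjective π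
  superfluous : ∀ U : Submodule A P, U ⊔ LinearMap.ker π = ⊤ → U = ⊤

end Basic

section CompositionFactors

variable {A : Type u} [Ring A]

/-- `[N : L] ≠ 0`: some composition series `0 = N₀ ⊂ N₁ ⊂ ⋯ ⊂ N_m = N` has a factor
`N_{j+1} / N_j` isomorphic to `L`. -/
def IsCompositionFactor (L N : Type u) [AddCommGroup L] [Module A L]
    [AddCommGroup N] [Module A N] : Prop :=
  ∃ s : CompositionSeries (Submodule A N), s.head = ⊥ ∧ s.last = ⊤ ∧
    ∃ j : Fin s.length,
      Nonempty ((s j.succ ⧸ (s j.castSucc).submoduleOf (s j.succ)) ≃ₗ[A] L)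

theorem exists_series_of_le {N : Type u} [AddCommGroup N] [Module A N] [IsNoetherian A N]
    [IsArtinian A N] {U V : Submodule A N} (h : U ≤ V) :
    ∃ s : CompositionSeries (Submodule A N), s.head = U ∧ s.last = V := by
  obtain ⟨f, f0, n, fn, hn⟩ := exists_covBy_seq_of_wellFoundedLT_wellFoundedGT_of_le h
  exact ⟨⟨n, fun i ↦ f i, fun i ↦ hn i i.2⟩, f0, fn⟩

/-- For a module of finite length and a simple module `L`, being a composition factor is the same
as being a quotient of a submodule. -/
theorem isCompositionFactor_iff {L N : Type u} [AddCommGroup L] [Module A L]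
    [AddCommGroup N] [Module A N] [IsNoetherian A N] [IsArtinian A N] :
    IsCompositionFactor (A := A) L N ↔ IsSimpleModule A L ∧
      ∃ (U : Submodule A N) (g : U →ₗ[A] L), Function.Surjective g := by
  constructor
  · rintro ⟨s, -, -, j, ⟨e⟩⟩
    refine ⟨?_, s j.succ, e.toLinearMap ∘ₗ Submodule.mkQ _,
      e.surjective.comp (Submodule.mkQ_surjective _)⟩
    have cov : s j.castSucc ⋖ s j.succ := s.step j
    have : IsSimpleModule A (s j.succ ⧸ (s j.castSucc).submoduleOf (s j.succ)) :=
      (covBy_iff_quot_is_simple cov.le).mp cov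
    exact IsSimpleModule.congr e.symm
  · rintro ⟨hL, U, g, hg⟩
    let V : Submodule A N := (LinearMap.ker g).map U.subtype
    have hVU : V ≤ U := Submodule.map_subtype_le U _
    have hV : V.submoduleOf U = LinearMap.ker g :=
      Submodule.comap_map_eq_of_injective U.injective_subtype _
    have e : (U ⧸ V.submoduleOf U) ≃ₗ[A] L :=
      (Submodule.quotEquivOfEq _ _ hV).trans (g.quotKerEquivOfSurjective hg)
    have cov : V ⋖ U := (covBy_iff_quot_is_simple hVU).mpr (IsSimpleModule.congr e)
    obtain ⟨p, p0, p1⟩ := exists_series_of_le (bot_le : ⊥ ≤ V)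
    obtain ⟨q, q0, q1⟩ := exists_series_of_le (le_top : U ≤ ⊤)
    have cov' : p.last ⋖ q.head := by rwa [p1, q0]
    let j : Fin (p.append q cov').length := ⟨p.length, by simp [RelSeries.append]⟩
    have h0 : p.append q cov' j.castSucc = V := by
      rw [← p1]
      exact RelSeries.append_apply_left p q cov' (Fin.last _)
    have h1 : p.append q cov' j.succ = U := by
      rw [← q0]
      exact RelSeries.append_apply_right p q cov' 0
    refine ⟨p.append q cov', by simpa using p0, by simpa using q1, j, ?_⟩
    rw [h0, h1]
    exact ⟨e⟩

end CompositionFactors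

section SerreSubcategory

variable {A : Type u} [Ring A] {n : ℕ}

/-- The full subcategory `N_S` of `A`-mod: all modules `N` such that `[N : L i] ≠ 0` implies
`i ∈ S`. -/
def serreSubcategory (L : Fin n → FGModuleCat.{u} A) (S : Set (Fin n)) :
    ObjectProperty (FGModuleCat.{u} A) :=
  fun N => ∀ i, IsCompositionFactor (A := A) (L i) N → i ∈ S

theorem isCompositionFactor_of_injective [IsArtinianRing A] {L M N : FGModuleCat.{u} A}
    (f : M →ₗ[A] N) (hf : Function.Injective f) (h : IsCompositionFactor (A := A) L M) :
    IsCompositionFactor (A := A) L N := by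
  rw [isCompositionFactor_iff] at h ⊢
  obtain ⟨hL, U, g, hg⟩ := h
  exact ⟨hL, U.map f, g ∘ₗ (Submodule.equivMapOfInjective f hf U).symm.toLinearMap,
    hg.comp (Submodule.equivMapOfInjective f hf U).symm.surjective⟩

theorem isCompositionFactor_of_surjective [IsArtinianRing A] {L M N : FGModuleCat.{u} A}
    (f : M →ₗ[A] N) (hf : Function.Surjective f) (h : IsCompositionFactor (A := A) L N) :
    IsCompositionFactor (A := A) L M := by
  rw [isCompositionFactor_iff] at h ⊢
  obtain ⟨hL, U, g, hg⟩ := h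
  refine ⟨hL, U.comap f, g ∘ₗ f.restrict (fun x hx => hx), hg.comp ?_⟩
  rintro ⟨y, hy⟩
  obtain ⟨x, rfl⟩ := hf y
  exact ⟨⟨x, hy⟩, rfl⟩

theorem isCompositionFactor_of_exact [IsArtinianRing A] {L M₁ M₂ M₃ : FGModuleCat.{u} A}
    (f : M₁ →ₗ[A] M₂) (q : M₂ →ₗ[A] M₃) (hfq : Function.Exact f q)
    (h : IsCompositionFactor (A := A) L M₂) :
    IsCompositionFactor (A := A) L M₁ ∨ IsCompositionFactor (A := A) L M₃ := by
  simp only [isCompositionFactor_iff] at h ⊢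
  obtain ⟨hL, U, g, hg⟩ := h
  let g₁ : U.comap f →ₗ[A] L := g ∘ₗ f.restrict (fun x hx => hx)
  rcases g₁.surjective_or_eq_zero with h₁ | h₁
  · exact Or.inl ⟨hL, _, g₁, h₁⟩
  · right
    let q' : U →ₗ[A] M₃ := q ∘ₗ U.subtype
    have hker : LinearMap.ker q' ≤ LinearMap.ker g := by
      rintro ⟨x, hx⟩ hqx
      obtain ⟨y, rfl⟩ := (hfq x).mp hqx
      exact LinearMap.congr_fun h₁ ⟨y, hx⟩
    refine ⟨hL, LinearMap.range q',
      (LinearMap.ker q').liftQ g hker ∘ₗ q'.quotKerEquivRange.symm.toLinearMap, ?_⟩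
    intro l
    obtain ⟨x, rfl⟩ := hg l
    refine ⟨q'.quotKerEquivRange (Submodule.Quotient.mk x), ?_⟩
    simp

theorem injective_of_mono [IsArtinianRing A] {M N : FGModuleCat.{u} A} (f : M ⟶ N) [Mono f] :
    Function.Injective f.hom.hom :=
  (ModuleCat.mono_iff_injective _).mp
    (inferInstanceAs (Mono ((forget₂ (FGModuleCat.{u} A) (ModuleCat.{u} A)).map f)))

theorem surjective_of_epi [IsArtinianRing A] {M N : FGModuleCat.{u} A} (f : M ⟶ N) [Epi f] :
    Function.Surjective f.hom.hom :=
  (ModuleCat.epi_iff_surjective _).mp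
    (inferInstanceAs (Epi ((forget₂ (FGModuleCat.{u} A) (ModuleCat.{u} A)).map f)))

instance [IsArtinianRing A] (L : Fin n → FGModuleCat.{u} A) (S : Set (Fin n)) :
    (serreSubcategory L S).IsSerreClass where
  exists_zero := by
    refine ⟨FGModuleCat.of A PUnit, ?_, fun i h => ?_⟩
    · rw [Limits.IsZero.iff_id_eq_zero]
      ext
    · rw [isCompositionFactor_iff] at h
      obtain ⟨hL, U, g, hg⟩ := h
      have : Subsingleton (FGModuleCat.of A PUnit.{u + 1}) := inferInstanceAs (Subsingleton PUnit)
      exact absurd hg.subsingleton (not_subsingleton_iff_nontrivial.mpr hL.nontrivial)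
  prop_of_mono f _ hY i h :=
    hY i (isCompositionFactor_of_injective f.hom.hom (injective_of_mono f) h)
  prop_of_epi f _ hX i h :=
    hX i (isCompositionFactor_of_surjective f.hom.hom (surjective_of_epi f) h)
  prop_X₂_of_shortExact {T} hT h₁ h₃ i h := by
    have hE := hT.exact.map (forget₂ (FGModuleCat.{u} A) (ModuleCat.{u} A))
    have hE' := (ShortComplex.ShortExact.moduleCat_exact_iff_function_exact _).mp hE
    exact (isCompositionFactor_of_exact T.f.hom.hom T.g.hom.hom hE' h).elim (h₁ i) (h₃ i)

/-- The Serre quotient `A`-mod `/ N_S`: the localization of `A`-mod at all homomorphisms with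
kernel and cokernel in `N_S`. -/
abbrev SerreQuotient [IsArtinianRing A] (L : Fin n → FGModuleCat.{u} A) (S : Set (Fin n)) :=
  (serreSubcategory L S).isoModSerre.Localization

/-- The canonical functor `A`-mod `⥤` `A`-mod `/ N_S`. -/
noncomputable abbrev quotientFunctor [IsArtinianRing A] (L : Fin n → FGModuleCat.{u} A)
    (S : Set (Fin n)) : FGModuleCat.{u} A ⥤ SerreQuotient L S :=
  (serreSubcategory L S).isoModSerre.Q

end SerreSubcategory

section Presentations

variable {A : Type u} [Ring A]

/-- `add(X)`: modules isomorphic to a finite direct sum of direct summands of `X`. -/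
def addClosure (X : FGModuleCat.{u} A) : ObjectProperty (FGModuleCat.{u} A) :=
  fun Y => ∃ (m : ℕ) (Z : Fin m → FGModuleCat.{u} A),
    (∀ j, ∃ W : FGModuleCat.{u} A, Nonempty (X ≃ₗ[A] Z j × W)) ∧
    Nonempty (Y ≃ₗ[A] (∀ j, Z j))

/-- Modules `Y` with an exact sequence `X₁ → X₀ → Y → 0`, where `X₀` and `X₁` are in `add(X)`. -/
def presentedBy (X : FGModuleCat.{u} A) : ObjectProperty (FGModuleCat.{u} A) :=
  fun Y => ∃ (X₁ X₀ : FGModuleCat.{u} A) (f : X₁ →ₗ[A] X₀) (g : X₀ →ₗ[A] Y),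
    addClosure X X₁ ∧ addClosure X X₀ ∧ Function.Exact f g ∧ Function.Surjective g

/-- `P_T = ⨁_{i ∈ T} P_i` (the index set is finite, so the direct sum is the product). -/
noncomputable def partialSum {n : ℕ} (P : Fin n → FGModuleCat.{u} A) (T : Set (Fin n)) :
    FGModuleCat.{u} A :=
  FGModuleCat.of A (∀ i : T, P i)

/-- `B = End_A(X)ᵒᵖ`. The product `f * g` of `End X` is the composition `f ∘ g` of maps. -/
abbrev EndOp (X : FGModuleCat.{u} A) : Type u := (End X)ᵐᵒᵖ

theorem finite_hom (k : Type w) [Field k] [Algebra k A] [Module.Finite k A]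
    (X Y : FGModuleCat.{u} A) : Module.Finite (EndOp X) (X ⟶ Y) := by
  let _ : Module k X := Module.restrictScalars k A X
  let _ : Module k Y := Module.restrictScalars k A Y
  have : IsScalarTower k A X := IsScalarTower.restrictScalars k A X
  have : IsScalarTower k A Y := IsScalarTower.restrictScalars k A Y
  have : Module.Finite k X := Module.Finite.trans A X
  have : Module.Finite k Y := Module.Finite.trans A Y
  let φ : (X ⟶ Y) →ₗ[k] (X →ₗ[k] Y) :=
    { toFun := fun f => f.hom.hom.restrictScalars k
      map_add' := fun _ _ => rfl
      map_smul' := fun _ _ => rfl }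
  have hφ : Function.Injective φ := fun f g h => by
    ext x
    exact LinearMap.congr_fun h x
  have : Module.Finite k (X ⟶ Y) := Module.Finite.of_injective φ hφ
  have : IsScalarTower k (EndOp X) (X ⟶ Y) := ⟨fun c b f => by
    change (c • b.unop) ≫ f = c • (b.unop ≫ f)
    exact Linear.smul_comp _ _ _ _ _ _⟩
  exact Module.Finite.of_restrictScalars_finite k (EndOp X) (X ⟶ Y)

/-- The functor `Hom_A(X, -)` from `A`-mod to `End_A(X)ᵒᵖ`-mod, where `End_A(X)ᵒᵖ` acts on
`Hom_A(X, Y)` by precomposition. -/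
noncomputable def homFunctor (k : Type w) [Field k] [Algebra k A] [Module.Finite k A]
    (X : FGModuleCat.{u} A) : FGModuleCat.{u} A ⥤ FGModuleCat.{u} (EndOp X) :=
  (ModuleCat.isFG.{u} (EndOp X)).lift (preadditiveCoyonedaObj X) fun Y => finite_hom k X Y

end Presentations

end SerreQuot

/-!
For a projective object `X` the functor `Hom(X, -)` is exact, and it is fully faithful out of every
object presented by `X`: this is clear for summands of `Xᵐ`, and passes to cokernels. A finitely
presented `End(X)ᵒᵖ`-module is the cokernel of a map between free modules `Hom(X, Xᵐ)`, so
`Hom(X, -)` is an equivalence from the objects presented by `X` to `End(X)ᵒᵖ`-mod. Since it is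
bijective on all morphisms out of these objects, its quasi-inverse is a fully faithful left adjoint
of `Hom(X, -)` on the whole category. Hence `Hom(X, -)` is a localization at the morphisms it
inverts, which by exactness are those whose kernel and cokernel it kills. For `X = P_{S'}` the
objects it kills form `N_S`, because `Hom(P_i, M) ≠ 0` if and only if `L_i` is a composition
factor of `M`.
-/

universe v

namespace SerreQuot

open Limits

section FullyFaithfulOut

variable {C D : Type*} [Category C] [Category D]

/-- The objects `Y` such that `G` is bijective on all morphisms out of `Y`. These are the objects
on which a quasi-inverse of `G` behaves as a left adjoint of `G`. -/
def fullyFaithfulOut (G : C ⥤ D) : ObjectProperty C :=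
  fun Y => ∀ Z, Function.Bijective (G.map : (Y ⟶ Z) → (G.obj Y ⟶ G.obj Z))

theorem fullyFaithfulOut_comp {E : Type*} [Category E] (G : C ⥤ D) (H : D ⥤ E) [H.Full]
    [H.Faithful] : fullyFaithfulOut (G ⋙ H) = fullyFaithfulOut G := by
  ext Y
  exact forall_congr' fun Z => Function.Bijective.of_comp_iff'
    (Functor.FullyFaithful.ofFullyFaithful H).homEquiv.bijective G.map

variable {G : C ⥤ D} {P : ObjectProperty C}

/-- The hom-set bijection of a partial left adjoint of `G` that sends `N ≅ G.obj Y` to `Y`; it maps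
`f` to `α.inv ≫ G.map f`. -/
noncomputable def fullyFaithfulOut.homEquiv {Y : C} (hY : fullyFaithfulOut G Y) {N : D}
    (α : G.obj Y ≅ N) (Z : C) : (Y ⟶ Z) ≃ (N ⟶ G.obj Z) :=
  (Equiv.ofBijective G.map (hY Z)).trans α.homFromEquiv

theorem fullyFaithfulOut.homEquiv_comp {Y : C} (hY : fullyFaithfulOut G Y) {N : D}
    (α : G.obj Y ≅ N) {Z Z' : C} (f : Y ⟶ Z) (g : Z ⟶ Z') :
    hY.homEquiv α Z' (f ≫ g) = hY.homEquiv α Z f ≫ G.map g := by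
  simp [homEquiv]

theorem fullyFaithfulOut.homEquiv_symm_comp {Y Y' : C} (hY : fullyFaithfulOut G Y)
    (hY' : fullyFaithfulOut G Y') {N N' : D} {α : G.obj Y ≅ N} {α' : G.obj Y' ≅ N'}
    {u : Y' ⟶ Y} {f : N' ⟶ N} (huf : G.map u ≫ α.hom = α'.hom ≫ f) {Z : C} (g : N ⟶ G.obj Z) :
    (hY'.homEquiv α' Z).symm (f ≫ g) = u ≫ (hY.homEquiv α Z).symm g := by
  obtain ⟨h, rfl⟩ := (hY.homEquiv α Z).surjective g
  rw [Equiv.symm_apply_apply, Equiv.symm_apply_eq]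
  have comp_inv : f ≫ α.inv = α'.inv ≫ G.map u := by
    rw [Iso.comp_inv_eq, Category.assoc, huf, Iso.inv_hom_id_assoc]
  simp [homEquiv, reassoc_of% comp_inv]

theorem isEquivalence_ι_comp (hP : P ≤ fullyFaithfulOut G) [(P.ι ⋙ G).EssSurj] :
    (P.ι ⋙ G).IsEquivalence where
  faithful := ⟨fun {Y Z _ _} h => P.hom_ext ((hP Y.obj Y.property Z.obj).1 h)⟩
  full := ⟨fun {Y Z} φ =>
    let ⟨f, hf⟩ := (hP Y.obj Y.property Z.obj).2 φ
    ⟨P.homMk f, hf⟩⟩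

/-- The quasi-inverse of the restriction of `G` to `P`, as a left adjoint of the unrestricted
functor `G`. -/
noncomputable def invCompιAdjunction (hP : P ≤ fullyFaithfulOut G)
    [(P.ι ⋙ G).IsEquivalence] : (P.ι ⋙ G).inv ⋙ P.ι ⊣ G :=
  let e := (P.ι ⋙ G).asEquivalence
  have h (N : D) : fullyFaithfulOut G (e.inverse.obj N).obj := hP _ (e.inverse.obj N).property
  Adjunction.mkOfHomEquiv
    { homEquiv N M := (h N).homEquiv (e.counitIso.app N) M
      homEquiv_naturality_left_symm {N' N _} f g :=
        (h N).homEquiv_symm_comp (h N') (e.counitIso.hom.naturality f) g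
      homEquiv_naturality_right {N _ _} f g := (h N).homEquiv_comp (e.counitIso.app N) f g }

theorem isLocalization_inverseImage_isomorphisms (hP : P ≤ fullyFaithfulOut G)
    [(P.ι ⋙ G).IsEquivalence] :
    G.IsLocalization ((MorphismProperty.isomorphisms D).inverseImage G) :=
  (invCompιAdjunction hP).isLocalization_rightAdjoint'

end FullyFaithfulOut

section LocalizationEquivalence

variable {C D : Type*} [Category C] [Category D] (G : C ⥤ D) (P : ObjectProperty C)
  [(P.ι ⋙ G).IsEquivalence] (W : MorphismProperty C) [G.IsLocalization W]

/-- If `G` is a localization at `W` and restricts to an equivalence on `P`, then the localized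
category is equivalent to `P`, via the target of `G`. -/
noncomputable def localizationEquivalence : W.Localization ≌ P.FullSubcategory :=
  (Localization.equivalenceFromModel G W).trans (P.ι ⋙ G).asEquivalence.symm

/-- The quasi-inverse of `localizationEquivalence` is the localization functor, restricted to
`P`. -/
noncomputable def localizationEquivalenceInverseIso :
    (localizationEquivalence G P W).inverse ≅ P.ι ⋙ W.Q :=
  P.ι.associator G _ ≪≫
    P.ι.isoWhiskerLeft (Localization.compEquivalenceFromModelInverseIso G W)

theorem localizationEquivalence_functor_linear (k : Type*) [Ring k] [Preadditive C] [Linear k C]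
    [Preadditive D] [Linear k D] [G.Linear k] [Preadditive W.Localization]
    [Linear k W.Localization] [W.Q.Linear k] :
    (localizationEquivalence G P W).functor.Linear k := by
  have : Localization.Lifting W.Q W G (Localization.equivalenceFromModel G W).functor :=
    ⟨Localization.qCompEquivalenceFromModelFunctorIso G W⟩
  have : (Localization.equivalenceFromModel G W).functor.Linear k :=
    (Localization.functor_linear_iff W.Q W k G _).mp inferInstance
  have : (P.ι ⋙ G).asEquivalence.functor.Linear k := inferInstanceAs ((P.ι ⋙ G).Linear k)
  exact inferInstanceAs
    (((Localization.equivalenceFromModel G W).functor ⋙ (P.ι ⋙ G).asEquivalence.inverse).Linear k)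

end LocalizationEquivalence

theorem inverseImage_isomorphisms_comp {C D E : Type*} [Category C] [Category D] [Category E]
    (G : C ⥤ D) (H : D ⥤ E) [H.ReflectsIsomorphisms] :
    (MorphismProperty.isomorphisms E).inverseImage (G ⋙ H) =
      (MorphismProperty.isomorphisms D).inverseImage G := by
  ext X Y f
  exact isIso_iff_of_reflects_iso (G.map f) H

theorem fullyFaithfulOut_of_exact {C D : Type*} [Category C] [Preadditive C] [Balanced C]
    [Category D] [HasZeroMorphisms D] (F : C ⥤ D) [F.PreservesZeroMorphisms]
    [F.PreservesEpimorphisms] {S : ShortComplex C} (hS : S.Exact) [Epi S.g]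
    (h₁ : fullyFaithfulOut F S.X₁) (h₂ : fullyFaithfulOut F S.X₂) :
    fullyFaithfulOut F S.X₃ := by
  refine fun Z => ⟨fun a b hab => ?_, fun φ => ?_⟩
  · rw [← cancel_epi S.g]
    apply (h₂ Z).1
    rw [F.map_comp, F.map_comp, hab]
  · obtain ⟨a, ha⟩ := (h₂ Z).2 (F.map S.g ≫ φ)
    have hfa : S.f ≫ a = 0 := by
      apply (h₁ Z).1
      rw [F.map_comp, ha, ← F.map_comp_assoc, S.zero, F.map_zero, F.map_zero, zero_comp]
    refine ⟨hS.desc a hfa, ?_⟩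
    rw [← cancel_epi (F.map S.g), ← F.map_comp, hS.g_desc, ha]

section PreadditiveCoyoneda

theorem fullyFaithfulOut_preadditiveCoyonedaObj {C : Type u} [Category.{v} C] [Preadditive C]
    {X Y : C} {ι : Type*} [Fintype ι] {s : ι → (Y ⟶ X)} {r : ι → (X ⟶ Y)}
    (hsr : ∑ i, s i ≫ r i = 𝟙 Y) : fullyFaithfulOut (preadditiveCoyonedaObj X) Y := by
  refine fun Z => ⟨fun f f' h => ?_, fun φ => ?_⟩
  · have comp_eq (a : X ⟶ Y) : a ≫ f = a ≫ f' := ConcreteCategory.congr_hom h a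
    rw [← Category.id_comp f, ← Category.id_comp f', ← hsr]
    simp only [Preadditive.sum_comp, Category.assoc, comp_eq]
  · let ψ : (X ⟶ Y) →ₗ[(End X)ᵐᵒᵖ] (X ⟶ Z) := φ.hom
    have ψ_comp (b : X ⟶ X) (g : X ⟶ Y) : ψ (b ≫ g) = b ≫ ψ g := ψ.map_smul (MulOpposite.op b) g
    refine ⟨∑ i, s i ≫ ψ (r i), ModuleCat.hom_ext <| LinearMap.ext fun g : X ⟶ Y => ?_⟩
    calc g ≫ ∑ i, s i ≫ ψ (r i)
        = ∑ i, (g ≫ s i) ≫ ψ (r i) := by simp only [Preadditive.comp_sum, Category.assoc]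
      _ = ψ (∑ i, (g ≫ s i) ≫ r i) := by simp only [map_sum, ψ_comp]
      _ = ψ g := by simp only [Category.assoc, ← Preadditive.comp_sum, hsr, Category.comp_id]

theorem kernel_preadditiveCoyonedaObj_iff {C : Type u} [Category.{v} C] [Preadditive C] (X M : C) :
    (preadditiveCoyonedaObj X).kernel M ↔ ∀ f : X ⟶ M, f = 0 :=
  ModuleCat.isZero_iff_subsingleton.trans (subsingleton_iff_forall_eq (0 : X ⟶ M))

/-- `Hom(X, Xⁿ)` is the free `End(X)ᵒᵖ`-module of rank `n`. -/
noncomputable def preadditiveCoyonedaObjBiproductIso {C : Type u} [Category.{v} C] [Preadditive C]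
    [HasFiniteBiproducts C] (X : C) (n : ℕ) :
    (preadditiveCoyonedaObj X).obj (⨁ fun _ : Fin n => X) ≅
      ModuleCat.of (End X)ᵐᵒᵖ (Fin n → (End X)ᵐᵒᵖ) :=
  (preadditiveCoyonedaObj X).mapBiproduct _ ≪≫ ModuleCat.biproductIsoPi _ ≪≫
    (LinearEquiv.piCongrRight fun _ : Fin n =>
      ({ MulOpposite.opAddEquiv with map_smul' := fun _ _ => rfl } :
        (X ⟶ X) ≃ₗ[(End X)ᵐᵒᵖ] (End X)ᵐᵒᵖ)).toModuleIso

attribute [local instance] Abelian.hasFiniteBiproducts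

theorem exists_preadditiveCoyonedaObj_cokernel_iso {C : Type u} [Category.{v} C] [Abelian C]
    (X : C) [Projective X] (N : ModuleCat.{v} (End X)ᵐᵒᵖ)
    [Module.FinitePresentation (End X)ᵐᵒᵖ N] :
    ∃ (m n : ℕ) (f : (⨁ fun _ : Fin m => X) ⟶ ⨁ fun _ : Fin n => X),
      Nonempty ((preadditiveCoyonedaObj X).obj (cokernel f) ≅ N) := by
  obtain ⟨n, m, q, p, hq, hpq⟩ := Module.FinitePresentation.exists_fin' (End X)ᵐᵒᵖ N
  let α (l : ℕ) := preadditiveCoyonedaObjBiproductIso X l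
  have fullyFaithfulOut_biproduct :
      fullyFaithfulOut (preadditiveCoyonedaObj X) (⨁ fun _ : Fin m => X) :=
    fullyFaithfulOut_preadditiveCoyonedaObj biproduct.total
  obtain ⟨f, hf⟩ :=
    (fullyFaithfulOut_biproduct _).2 ((α m).hom ≫ ModuleCat.ofHom p ≫ (α n).inv)
  have comm : (α m).hom ≫ ModuleCat.ofHom p = (preadditiveCoyonedaObj X).map f ≫ (α n).hom := by
    rw [hf, Category.assoc, Category.assoc, Iso.inv_hom_id, Category.comp_id]
  exact ⟨m, n, f, ⟨CokernelCofork.mapIsoOfIsColimit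
    (CokernelCofork.mapIsColimit _ (cokernelIsCokernel f) (preadditiveCoyonedaObj X))
    (ModuleCat.isColimitCokernelCofork _ (ModuleCat.ofHom q) hpq hq)
    (Arrow.isoMk (α m) (α n) comm)⟩⟩

end PreadditiveCoyoneda

section ProjectiveCover

variable {A : Type u} [Ring A] {P L : Type u} [AddCommGroup P] [Module A P] [AddCommGroup L]
  [Module A L] [IsSimpleModule A L] {π : P →ₗ[A] L}

theorem IsProjectiveCover.ker_le_ker (hπ : IsProjectiveCover π) {M : Type*} [AddCommGroup M]
    [Module A M] {f : P →ₗ[A] M} (hf : f ≠ 0) : LinearMap.ker f ≤ LinearMap.ker π := by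
  have coatom : IsCoatom (LinearMap.ker π) :=
    isSimpleModule_iff_isCoatom.mp
      (IsSimpleModule.congr (π.quotKerEquivOfSurjective hπ.surjective))
  by_contra hle
  exact hf (LinearMap.ker_eq_top.mp
    (hπ.superfluous _ (coatom.2 _ (right_lt_sup.mpr hle))))

theorem IsProjectiveCover.isCompositionFactor_iff (hπ : IsProjectiveCover π) {M : Type u}
    [AddCommGroup M] [Module A M] [IsNoetherian A M] [IsArtinian A M] :
    IsCompositionFactor (A := A) L M ↔ ∃ f : P →ₗ[A] M, f ≠ 0 := by
  rw [SerreQuot.isCompositionFactor_iff]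
  constructor
  · rintro ⟨hL, U, g, hg⟩
    have := hL.nontrivial
    have := hπ.projective
    obtain ⟨h, hh⟩ := Module.projective_lifting_property g π hg
    refine ⟨U.subtype ∘ₗ h, fun comp_eq_zero => LinearMap.ne_zero_of_surjective hπ.surjective ?_⟩
    have h_eq_zero : h = 0 :=
      (LinearMap.cancel_left U.injective_subtype).mp (by rw [comp_eq_zero, LinearMap.comp_zero])
    rw [← hh, h_eq_zero, LinearMap.comp_zero]
  · rintro ⟨f, hf⟩
    refine ⟨inferInstance, LinearMap.range f,
      (LinearMap.ker f).liftQ π (hπ.ker_le_ker hf) ∘ₗ f.quotKerEquivRange.symm.toLinearMap, ?_⟩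
    rw [← LinearMap.range_eq_top, LinearMap.range_comp_of_range_eq_top _ (LinearEquiv.range _),
      Submodule.range_liftQ, LinearMap.range_eq_top.mpr hπ.surjective]

end ProjectiveCover

theorem forall_linearMap_pi_eq_zero_iff {R ι M : Type*} {φ : ι → Type*} [Finite ι] [Semiring R]
    [AddCommMonoid M] [Module R M] [∀ i, AddCommMonoid (φ i)] [∀ i, Module R (φ i)] :
    (∀ f : (∀ i, φ i) →ₗ[R] M, f = 0) ↔ ∀ i (f : φ i →ₗ[R] M), f = 0 := by
  classical
  refine ⟨fun h i f => ?_, fun h f => LinearMap.pi_ext' fun i => ?_⟩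
  · rw [← f.comp_id, ← LinearMap.proj_comp_single_same R φ i, ← LinearMap.comp_assoc,
      h (f ∘ₗ LinearMap.proj i), LinearMap.zero_comp]
  · rw [h i (f ∘ₗ _), LinearMap.zero_comp]

section FGModuleCat

variable {A : Type u} [Ring A] {X Y : FGModuleCat.{u} A}

theorem addClosure.exists_sum_comp_eq_id (hY : addClosure X Y) :
    ∃ (m : ℕ) (s : Fin m → (Y ⟶ X)) (r : Fin m → (X ⟶ Y)), ∑ j, s j ≫ r j = 𝟙 Y := by
  obtain ⟨m, Z, hZ, ⟨e⟩⟩ := hY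
  choose W hW using hZ
  let d j := (hW j).some
  let s j : Y →ₗ[A] X :=
    (d j).symm.toLinearMap ∘ₗ LinearMap.inl A (Z j) (W j) ∘ₗ LinearMap.proj j ∘ₗ e.toLinearMap
  let r j : X →ₗ[A] Y :=
    e.symm.toLinearMap ∘ₗ LinearMap.single A _ j ∘ₗ LinearMap.fst A (Z j) (W j) ∘ₗ
      (d j).toLinearMap
  have sum_comp : ∑ j, r j ∘ₗ s j = LinearMap.id := by
    ext y
    simp [s, r, ← map_sum, Finset.univ_sum_single]
  refine ⟨m, fun j => FGModuleCat.ofHom (s j), fun j => FGModuleCat.ofHom (r j),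
    (ModuleCat.isFG.{u} A).ι.map_injective <| ModuleCat.hom_ext ?_⟩
  rw [Functor.map_sum, ModuleCat.hom_sum]
  exact sum_comp

variable [IsArtinianRing A]

theorem serreSubcategory_eq_kernel {n : ℕ} {L P : Fin n → FGModuleCat.{u} A}
    (hL : ∀ i, IsSimpleModule A (L i)) {π : ∀ i, P i →ₗ[A] L i}
    (hπ : ∀ i, IsProjectiveCover (π i)) (S : Set (Fin n)) :
    serreSubcategory L S = (preadditiveCoyonedaObj (partialSum P Sᶜ)).kernel := by
  ext M
  calc serreSubcategory L S M
      ↔ ∀ i : (Sᶜ : Set (Fin n)), ¬ ∃ f : P i →ₗ[A] M, f ≠ 0 := by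
        simp only [serreSubcategory, (hπ _).isCompositionFactor_iff, Subtype.forall,
          Set.mem_compl_iff]
        exact forall_congr' fun i => not_imp_not.symm
    _ ↔ ∀ f : (∀ i : (Sᶜ : Set (Fin n)), P i) →ₗ[A] M, f = 0 := by
        simp only [not_exists, not_not, forall_linearMap_pi_eq_zero_iff]
    _ ↔ ∀ f : partialSum P Sᶜ ⟶ M, f = 0 :=
        ⟨fun h f => ObjectProperty.hom_ext _ (ModuleCat.hom_ext (h f.hom.hom)),
          fun h f => congrArg (·.hom.hom) (h (FGModuleCat.ofHom f))⟩
    _ ↔ (preadditiveCoyonedaObj (partialSum P Sᶜ)).kernel M :=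
        (kernel_preadditiveCoyonedaObj_iff _ _).symm

theorem projective_of_module_projective (X : FGModuleCat.{u} A) [Module.Projective A X] :
    Projective X where
  factors f e _ := by
    obtain ⟨h, hh⟩ := Module.projective_lifting_property e.hom.hom f.hom.hom (surjective_of_epi e)
    exact ⟨FGModuleCat.ofHom h, by ext x; exact LinearMap.congr_fun hh x⟩

theorem projective_partialSum {n : ℕ} {P : Fin n → FGModuleCat.{u} A}
    (hP : ∀ i, Module.Projective A (P i)) (T : Set (Fin n)) : Projective (partialSum P T) := by
  classical
  have : Module.Projective A (partialSum P T) :=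
    Module.Projective.of_equiv (DFinsupp.linearEquivFunOnFintype (R := A) (M := fun i : T => P i))
  exact projective_of_module_projective _

theorem exact_iff_function_exact (S : ShortComplex (FGModuleCat.{u} A)) :
    S.Exact ↔ Function.Exact S.f.hom.hom S.g.hom.hom :=
  (S.exact_map_iff_of_faithful (forget₂ (FGModuleCat.{u} A) (ModuleCat.{u} A))).symm.trans
    (ShortComplex.ShortExact.moduleCat_exact_iff_function_exact _)

theorem presentedBy_of_exact {S : ShortComplex (FGModuleCat.{u} A)} (hS : S.Exact) [Epi S.g]
    (h₁ : addClosure X S.X₁) (h₂ : addClosure X S.X₂) : presentedBy X S.X₃ :=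
  ⟨S.X₁, S.X₂, S.f.hom.hom, S.g.hom.hom, h₁, h₂, (exact_iff_function_exact S).mp hS,
    surjective_of_epi S.g⟩

theorem presentedBy.exists_exact (hY : presentedBy X Y) :
    ∃ (X₁ X₀ : FGModuleCat.{u} A) (f : X₁ ⟶ X₀) (g : X₀ ⟶ Y) (w : f ≫ g = 0),
      addClosure X X₁ ∧ addClosure X X₀ ∧ (ShortComplex.mk f g w).Exact ∧ Epi g := by
  obtain ⟨X₁, X₀, f, g, h₁, h₀, hfg, hg⟩ := hY
  have w : FGModuleCat.ofHom f ≫ FGModuleCat.ofHom g = 0 := by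
    ext x
    exact hfg.apply_apply_eq_zero x
  exact ⟨X₁, X₀, _, _, w, h₁, h₀, (exact_iff_function_exact _).mpr hfg,
    ConcreteCategory.epi_of_surjective (FGModuleCat.ofHom g) hg⟩

attribute [local instance] Abelian.hasFiniteBiproducts

theorem addClosure_biproduct (X : FGModuleCat.{u} A) (m : ℕ) :
    addClosure X (⨁ fun _ : Fin m => X) :=
  ⟨m, fun _ => X, fun _ => ⟨FGModuleCat.of A PUnit, ⟨LinearEquiv.prodUnique.symm⟩⟩,
    ⟨((ModuleCat.isFG.{u} A).ι.mapBiproduct (fun _ : Fin m => X) ≪≫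
      ModuleCat.biproductIsoPi _).toLinearEquiv⟩⟩

end FGModuleCat

section HomFunctor

variable (k : Type w) [Field k] {A : Type u} [Ring A] [Algebra k A] [Module.Finite k A]
  (X : FGModuleCat.{u} A)

instance homFunctor_linear : (homFunctor k X).Linear k where
  map_smul {Y Z} f c := by
    ext g
    change g ≫ (c • f) = algebraMap k (EndOp X) c • (g ≫ f)
    rw [Algebra.algebraMap_eq_smul_one]
    change g ≫ (c • f) = (c • 𝟙 X) ≫ (g ≫ f)
    rw [Linear.smul_comp, Category.id_comp]
    exact Linear.comp_smul _ _ _ _ _ _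

theorem homFunctor_comp_ι :
    homFunctor k X ⋙ (ModuleCat.isFG.{u} (EndOp X)).ι = preadditiveCoyonedaObj X :=
  rfl

theorem finite_endOp : Module.Finite k (EndOp X) := by
  let _ : Module k X := Module.restrictScalars k A X
  have : IsScalarTower k A X := IsScalarTower.restrictScalars k A X
  have : Module.Finite k X := Module.Finite.trans A X
  let restrictScalars : EndOp X →ₗ[k] (X →ₗ[k] X) :=
    { toFun := fun f => f.unop.hom.hom.restrictScalars k
      map_add' := fun _ _ => rfl
      map_smul' := fun _ _ => rfl }
  refine Module.Finite.of_injective restrictScalars fun f g h => MulOpposite.unop_injective <|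
    ObjectProperty.hom_ext _ <| ModuleCat.hom_ext <| LinearMap.ext fun x => ?_
  exact LinearMap.congr_fun h x

variable [Projective X]

theorem presentedBy_le_fullyFaithfulOut : presentedBy X ≤ fullyFaithfulOut (homFunctor k X) := by
  have := IsArtinianRing.of_finite k A
  intro Y hY
  obtain ⟨X₁, X₀, f, g, w, h₁, h₀, hfg, _⟩ := hY.exists_exact
  have of_addClosure {Z} (hZ : addClosure X Z) : fullyFaithfulOut (preadditiveCoyonedaObj X) Z :=
    let ⟨_, _, _, hsr⟩ := hZ.exists_sum_comp_eq_id
    fullyFaithfulOut_preadditiveCoyonedaObj hsr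
  have fullyFaithfulOut_Y : fullyFaithfulOut (preadditiveCoyonedaObj X) Y :=
    fullyFaithfulOut_of_exact _ hfg (of_addClosure h₁) (of_addClosure h₀)
  rwa [← homFunctor_comp_ι k, fullyFaithfulOut_comp] at fullyFaithfulOut_Y

instance essSurj_ι_comp_homFunctor : ((presentedBy X).ι ⋙ homFunctor k X).EssSurj where
  mem_essImage N := by
    have := IsArtinianRing.of_finite k A
    have := finite_endOp k X
    have := IsNoetherianRing.of_finite k (EndOp X)
    have := Module.finitePresentation_of_finite (EndOp X) N
    obtain ⟨m, n, f, ⟨e⟩⟩ := exists_preadditiveCoyonedaObj_cokernel_iso X N.obj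
    have hf : presentedBy X (cokernel f) := presentedBy_of_exact
      (ShortComplex.exact_cokernel f) (addClosure_biproduct X m) (addClosure_biproduct X n)
    exact ⟨⟨_, hf⟩, ⟨(ModuleCat.isFG.{u} (EndOp X)).isoMk e⟩⟩

instance isEquivalence_ι_comp_homFunctor : ((presentedBy X).ι ⋙ homFunctor k X).IsEquivalence :=
  isEquivalence_ι_comp (presentedBy_le_fullyFaithfulOut k X)

theorem isLocalization_homFunctor [IsArtinianRing A] {Q : ObjectProperty (FGModuleCat.{u} A)}
    [Q.IsSerreClass] (hQ : Q = (preadditiveCoyonedaObj X).kernel) :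
    (homFunctor k X).IsLocalization Q.isoModSerre := by
  have isoModSerre_eq : Q.isoModSerre =
      (MorphismProperty.isomorphisms _).inverseImage (homFunctor k X) := by
    subst hQ
    rw [← inverseImage_isomorphisms_comp _ (ModuleCat.isFG.{u} (EndOp X)).ι]
    exact Abelian.isoModSerre_kernel_eq_inverseImage_isomorphisms (preadditiveCoyonedaObj X)
  rw [isoModSerre_eq]
  exact isLocalization_inverseImage_isomorphisms (presentedBy_le_fullyFaithfulOut k X)

end HomFunctor

end SerreQuot

open SerreQuot in
theorem mainTheorem9_general (k : Type w) [Field k]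
    (A : Type u) [Ring A] [Algebra k A] [Module.Finite k A]
    {n : ℕ} (L P : Fin n → FGModuleCat.{u} A) (hL_simple : ∀ i, IsSimpleModule A (L i))
    (π : ∀ i, P i →ₗ[A] L i) (hπ : ∀ i, IsProjectiveCover (π i)) (S : Set (Fin n)) :
    haveI : IsArtinianRing A := IsArtinianRing.of_finite k A
    ∃ (E : SerreQuotient L S ≌ (presentedBy (partialSum P Sᶜ)).FullSubcategory)
      (F : (presentedBy (partialSum P Sᶜ)).FullSubcategory ≌
          FGModuleCat.{u} (EndOp (partialSum P Sᶜ))),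
      E.functor.Linear k ∧ F.functor.Linear k ∧
      Nonempty (E.inverse ≅ (presentedBy (partialSum P Sᶜ)).ι ⋙ quotientFunctor L S) ∧
      Nonempty (F.functor ≅
        (presentedBy (partialSum P Sᶜ)).ι ⋙ homFunctor k (partialSum P Sᶜ)) := by
  have : IsArtinianRing A := IsArtinianRing.of_finite k A
  let X := partialSum P Sᶜ
  have : Projective X := projective_partialSum (fun i => (hπ i).projective) Sᶜ
  have : (homFunctor k X).IsLocalization (serreSubcategory L S).isoModSerre :=
    isLocalization_homFunctor k X (serreSubcategory_eq_kernel hL_simple hπ S)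
  exact ⟨localizationEquivalence (homFunctor k X) (presentedBy X) _,
    ((presentedBy X).ι ⋙ homFunctor k X).asEquivalence,
    localizationEquivalence_functor_linear _ _ _ k,
    inferInstanceAs (((presentedBy X).ι ⋙ homFunctor k X).Linear k),
    ⟨localizationEquivalenceInverseIso _ _ _⟩, ⟨Iso.refl _⟩⟩

theorem mainTheorem9 (k : Type w) [Field k] [IsAlgClosed k]
    (A : Type u) [Ring A] [Algebra k A] [Module.Finite k A]
    (hA : SerreQuot.IsBasicAlgebra k A)
    {n : ℕ} (L P : Fin n → FGModuleCat.{u} A)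
    (hL_simple : ∀ i, IsSimpleModule A (L i))
    (hL_noniso : ∀ i j, Nonempty (L i ≃ₗ[A] L j) → i = j)
    (hL_complete : ∀ M : FGModuleCat.{u} A, IsSimpleModule A M → ∃ i, Nonempty (M ≃ₗ[A] L i))
    (π : ∀ i, P i →ₗ[A] L i) (hπ : ∀ i, SerreQuot.IsProjectiveCover (π i))
    (S : Set (Fin n)) (hS : S ≠ Set.univ) :
    haveI : IsArtinianRing A := IsArtinianRing.of_finite k A
    ∃ (E : SerreQuot.SerreQuotient L S ≌
          (SerreQuot.presentedBy (SerreQuot.partialSum P Sᶜ)).FullSubcategory)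
      (F : (SerreQuot.presentedBy (SerreQuot.partialSum P Sᶜ)).FullSubcategory ≌
          FGModuleCat.{u} (SerreQuot.EndOp (SerreQuot.partialSum P Sᶜ))),
      E.functor.Linear k ∧ F.functor.Linear k ∧
      Nonempty (E.inverse ≅
        (SerreQuot.presentedBy (SerreQuot.partialSum P Sᶜ)).ι ⋙ SerreQuot.quotientFunctor L S) ∧
      Nonempty (F.functor ≅
        (SerreQuot.presentedBy (SerreQuot.partialSum P Sᶜ)).ι ⋙
          SerreQuot.homFunctor k (SerreQuot.partialSum P Sᶜ)) :=
  mainTheorem9_general k A L P hL_simple π hπ S
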